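/- Let $n\ge 0$ and let $\beta^{(i)},\mu^{(i)},\nu^{(i)}\in\mathbb Z^n$ ($i=1,\dots,n$) be such that the $n\times n$ matrix $\varkappa$ with columns $\mu^{(i)}-\nu^{(i)}$ is nondegenerate. Let $\overline\beta$ be the matrix with columns $\beta^{(i)}-\nu^{(i)}$. Consider the reduced trinomial system $$r_i\,y^{\beta^{(i)}}+y^{\mu^{(i)}}-y^{\nu^{(i)}}=0,\qquad i=1,\dots,n,$$ with unknown $y=(y_1,\dots,y_n)$ and variable coefficients $r=(r_1,\dots,r_n)\in\mathbb C^n$, where $y^{\alpha}=y_1^{\alpha_1}\cdots y_n^{\alpha_n}$. The system has a holomorphic solution $y(r)$ in a neighbourhood of $r=0$ with $y(0)=(1,\dots,1)$, and it is unique as a germ at $0$; it is called the principal solution. For every $d\in\mathbb R^n$ the monomial $y^d(r)=y_1(r)^{d_1}\cdots y_n(r)^{d_n}$ of the principal solution (with the principal branch of the powers, so that $y^d(0)=1$) has the Taylor expansion $$y^d(r)=\sum_{k\in\mathbb Z_{\ge 0}^n}c_k\,r^k,$$ absolutely convergent for all $r$ in a neighbourhood of $0$, with the coefficients $$c_k=\frac{(-1)^{|k|}}{k!}\,\frac{\Gamma(\varkappa^{-1}d+\varkappa^{-1}\overline\beta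 k)}{\Gamma(\varkappa^{-1}d+\varkappa^{-1}\overline\beta k-k+I)}\,Q(k),\qquad Q(k)=\det\bigl(\operatorname{diag}[\varkappa^{-1}d+\varkappa^{-1}\overline\beta k]-\varkappa^{-1}\overline\beta\,\operatorname{diag}[k]\bigr).$$ Here $k!=k_1!\cdots k_n!$, $|k|=k_1+\dots+k_n$, $I=(1,\dots,1)$, $\operatorname{diag}[b]$ is the diagonal matrix with the diagonal $b$, and $\Gamma(b)=\prod_{j=1}^n\Gamma(b_j)$ for a vector $b$. If a coordinate of $\varkappa^{-1}d+\varkappa^{-1}\overline\beta k$ is a pole of $\Gamma$, then $c_k$ means the value at $d$ of the right-hand side regarded as a meromorphic function of $d\in\mathbb C^n$; its singularities are removable. -/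

import Mathlib

open Filter Topology

/-- The `n × n` matrix whose `i`-th column is the integer vector `a i - b i`. -/
def columnDiff {n : ℕ} (a b : Fin n → Fin n → ℤ) : Matrix (Fin n) (Fin n) ℂ :=
  Matrix.of fun j i => ((a i j - b i j : ℤ) : ℂ)

/-- The Laurent monomial `y ^ α = y₁ ^ α₁ ⋯ yₙ ^ αₙ`. -/
noncomputable def laurentMonomial {n : ℕ} (α : Fin n → ℤ) (y : Fin n → ℂ) : ℂ :=
  ∏ j, y j ^ α j

/-- `y` is a principal solution of the reduced trinomial system
`r i * y ^ (β i) + y ^ (μ i) - y ^ (ν i) = 0`, `i = 1, …, n`: a holomorphic branch near `r = 0`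
of the solution, with the value `(1, …, 1)` at `r = 0`. -/
structure IsPrincipalSolution {n : ℕ} (β μ ν : Fin n → Fin n → ℤ)
    (y : (Fin n → ℂ) → (Fin n → ℂ)) : Prop where
  analyticAt_zero : AnalyticAt ℂ y 0
  apply_zero : ∀ j, y 0 j = 1
  solves : ∀ᶠ r in 𝓝 (0 : Fin n → ℂ), ∀ i,
    r i * laurentMonomial (β i) (y r) + laurentMonomial (μ i) (y r)
      - laurentMonomial (ν i) (y r) = 0

/-- The vector `κ⁻¹ d + κ⁻¹ B k`. -/
noncomputable def gammaArg {n : ℕ} (κ B : Matrix (Fin n) (Fin n) ℂ) (d : Fin n → ℂ)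
    (k : Fin n → ℕ) : Fin n → ℂ :=
  κ⁻¹.mulVec d + (κ⁻¹ * B).mulVec (fun i => (k i : ℂ))

/-- `Q(k) = det (diag [κ⁻¹ d + κ⁻¹ B k] - κ⁻¹ B diag [k])`. -/
noncomputable def detFactor {n : ℕ} (κ B : Matrix (Fin n) (Fin n) ℂ) (d : Fin n → ℂ)
    (k : Fin n → ℕ) : ℂ :=
  (Matrix.diagonal (gammaArg κ B d k)
    - κ⁻¹ * B * Matrix.diagonal (fun i => (k i : ℂ))).det

/-- The expression
`((-1) ^ |k| / k!) * Γ (κ⁻¹ d + κ⁻¹ B k) / Γ (κ⁻¹ d + κ⁻¹ B k - k + I) * Q(k)`,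
where `Γ` of a vector is the product of the values of `Γ` at its coordinates. -/
noncomputable def coeffFormula {n : ℕ} (κ B : Matrix (Fin n) (Fin n) ℂ) (d : Fin n → ℂ)
    (k : Fin n → ℕ) : ℂ :=
  (-1) ^ (∑ j, k j) / (∏ j, ((k j).factorial : ℂ))
    * ((∏ j, Complex.Gamma (gammaArg κ B d k j))
        / ∏ j, Complex.Gamma (gammaArg κ B d k j - (k j : ℂ) + 1))
    * detFactor κ B d k

/-- The vectors `d` for which no coordinate of `κ⁻¹ d + κ⁻¹ B k` is a pole of `Γ`. At these `d` the
expression `coeffFormula κ B d k` has its literal meaning (`1 / Γ` being `0` at the poles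
of `Γ`). -/
def regularSet {n : ℕ} (κ B : Matrix (Fin n) (Fin n) ℂ) (k : Fin n → ℕ) : Set (Fin n → ℂ) :=
  {d | ∀ j, ∀ m : ℕ, gammaArg κ B d k j ≠ -(m : ℂ)}

/-- `c` is the value at `d` of the meromorphic function `d' ↦ coeffFormula κ B d' k`, removable
singularities being removed. -/
def IsCoeffValue {n : ℕ} (κ B : Matrix (Fin n) (Fin n) ℂ) (d : Fin n → ℂ) (k : Fin n → ℕ)
    (c : ℂ) : Prop :=
  Tendsto (fun d' => coeffFormula κ B d' k) (𝓝[regularSet κ B k] d) (𝓝 c)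

/-! ### Generalized binomial coefficients -/

/-! Put `M = κ⁻¹ B`, where `B` is the matrix with columns `β i - ν i`, and let `u i = y ^ (μ i - ν
i)`. The system becomes `u i = 1 - r i * u ^ (M e_i)`, and `y ^ d = u ^ (κ⁻¹ d)`. So it suffices to
expand `u ^ δ` for every complex exponent vector `δ`.

Instead of inverting the system, one starts from the candidate series `F(δ)` (`goodSeries`), whose
coefficients are binomial determinants. They are polynomial in `δ`, `F(0) = 1`, and Pascal's rule
gives `F(δ + e_i) = F(δ) - r i * F(δ + M e_i)`. This equation is rigid: by induction on the total
degree, each coefficient of a solution vanishing at `δ = 0` is a polynomial in `δ` periodic in all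
coordinate directions, hence zero. Therefore `F(δ + δ') = F(δ) F(δ')` (`goodSeries_add`).

Exponential bounds make the series converge near `r = 0`, and holomorphy in the exponent upgrades
additivity to `F(t δ) = F(δ) ^ t` (`eventually_goodSum_smul`). Hence the functions `F(κ⁻¹ e_j)`
solve the trinomial system. The implicit function theorem identifies them with the principal
solution, so `y ^ d = F(κ⁻¹ d)`. The Gamma quotient is another form of the determinant
(`goodMatrix_det_eq`). -/

theorem Ring.choose_eq_prod_div (x : ℂ) (k : ℕ) :
    Ring.choose x k = (∏ j ∈ Finset.range k, (x - j)) / (k.factorial : ℂ) := by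
  have h := Ring.descPochhammer_eq_factorial_smul_choose x k
  rw [Polynomial.descPochhammer_smeval_eq_ascPochhammer, Polynomial.ascPochhammer_smeval_eq_eval]
    at h
  have h2 := descPochhammer_eval_eq_prod_range k x
  rw [descPochhammer_eval_eq_ascPochhammer] at h2
  rw [h2] at h
  rw [h, nsmul_eq_mul, mul_div_cancel_left₀]
  exact_mod_cast k.factorial_ne_zero

/-- The generalized binomial coefficient `x.choose (k - 1)`, read as `0` for `k = 0`. -/
noncomputable def choosePred (x : ℂ) : ℕ → ℂ
  | 0 => 0
  | k + 1 => Ring.choose x k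

theorem choose_add_one_eq_add_choosePred (x : ℂ) (k : ℕ) :
    Ring.choose (x + 1) k = Ring.choose x k + choosePred x k := by
  cases k with
  | zero => simp [choosePred]
  | succ k => rw [Ring.choose_succ_succ, choosePred, add_comm]

theorem natCast_mul_choose (x : ℂ) (k : ℕ) :
    (k : ℂ) * Ring.choose x k = x * choosePred (x - 1) k := by
  cases k with
  | zero => simp [choosePred]
  | succ k =>
    have h1 : ((k + 1 : ℕ) : ℂ) ≠ 0 := by exact_mod_cast k.succ_ne_zero
    have h2 : (k.factorial : ℂ) ≠ 0 := by exact_mod_cast k.factorial_ne_zero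
    have h3 : ∀ j : ℕ, x - ((j + 1 : ℕ) : ℂ) = x - 1 - j := fun j => by push_cast; ring
    simp only [choosePred, Ring.choose_eq_prod_div, Finset.prod_range_succ', Nat.factorial_succ,
      Nat.cast_mul, h3, Nat.cast_zero, sub_zero]
    field_simp

/-! ### Polynomial functions and their rigidity under integer translations -/

/-- `f` is given by a polynomial. -/
def IsPolynomialFun (f : ℂ → ℂ) : Prop := ∃ p : Polynomial ℂ, ∀ t, f t = p.eval t

namespace IsPolynomialFun

theorem const (c : ℂ) : IsPolynomialFun fun _ => c := ⟨Polynomial.C c, by simp⟩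

theorem linear (a b : ℂ) : IsPolynomialFun fun t => a + t * b :=
  ⟨Polynomial.C a + Polynomial.C b * Polynomial.X, fun t => by simp [mul_comm t]⟩

variable {f g : ℂ → ℂ}

theorem mul (hf : IsPolynomialFun f) (hg : IsPolynomialFun g) :
    IsPolynomialFun fun t => f t * g t := by
  obtain ⟨p, hp⟩ := hf
  obtain ⟨q, hq⟩ := hg
  exact ⟨p * q, by simp [hp, hq]⟩

theorem sub (hf : IsPolynomialFun f) (hg : IsPolynomialFun g) :
    IsPolynomialFun fun t => f t - g t := by
  obtain ⟨p, hp⟩ := hf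
  obtain ⟨q, hq⟩ := hg
  exact ⟨p - q, by simp [hp, hq]⟩

theorem sum {ι : Type*} (s : Finset ι) {F : ι → ℂ → ℂ} (h : ∀ i ∈ s, IsPolynomialFun (F i)) :
    IsPolynomialFun fun t => ∑ i ∈ s, F i t := by
  choose! p hp using h
  exact ⟨∑ i ∈ s, p i, fun t => by
    rw [Polynomial.eval_finsetSum]; exact Finset.sum_congr rfl fun i hi => hp i hi t⟩

theorem prod {ι : Type*} (s : Finset ι) {F : ι → ℂ → ℂ} (h : ∀ i ∈ s, IsPolynomialFun (F i)) :
    IsPolynomialFun fun t => ∏ i ∈ s, F i t := by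
  choose! p hp using h
  exact ⟨∏ i ∈ s, p i, fun t => by
    rw [Polynomial.eval_prod]; exact Finset.prod_congr rfl fun i hi => hp i hi t⟩

theorem choose (hf : IsPolynomialFun f) (k : ℕ) :
    IsPolynomialFun fun t => Ring.choose (f t) k := by
  simp only [Ring.choose_eq_prod_div, div_eq_mul_inv]
  exact (prod _ fun i _ => hf.sub (const _)).mul (const _)

theorem choosePred (hf : IsPolynomialFun f) (k : ℕ) :
    IsPolynomialFun fun t => _root_.choosePred (f t) k := by
  cases k with
  | zero => exact const 0
  | succ k => exact hf.choose k

theorem det {ι : Type*} [Fintype ι] [DecidableEq ι] {A : ℂ → Matrix ι ι ℂ}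
    (h : ∀ i j, IsPolynomialFun fun t => A t i j) : IsPolynomialFun fun t => (A t).det := by
  simp only [Matrix.det_apply']
  exact sum _ fun σ _ => (const _).mul (prod _ fun i _ => h _ _)

theorem differentiable (hf : IsPolynomialFun f) : Differentiable ℂ f := by
  obtain ⟨p, hp⟩ := hf
  rw [funext hp]
  exact p.differentiable

/-- A periodic polynomial is constant. -/
theorem eq_of_periodic (hf : IsPolynomialFun f) (hp : ∀ t, f (t + 1) = f t) (t : ℂ) :
    f t = f 0 := by
  obtain ⟨p, hp'⟩ := hf
  have hn : ∀ m : ℕ, f m = f 0 := by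
    intro m
    induction m with
    | zero => simp
    | succ m ih => rw [Nat.cast_succ, hp, ih]
  have : p = Polynomial.C (f 0) := by
    refine Polynomial.eq_of_infinite_eval_eq _ _
      ((Set.infinite_range_of_injective (Nat.cast_injective (R := ℂ))).mono ?_)
    rintro _ ⟨m, rfl⟩
    simp [← hp', hn]
  rw [hp', this, Polynomial.eval_C]

end IsPolynomialFun

/-- A function which is polynomial along lines and invariant under the translations by the
standard basis vectors is constant. -/
theorem eq_apply_zero_of_periodic {n : ℕ} {F : (Fin n → ℂ) → ℂ}
    (hF : ∀ x v, IsPolynomialFun fun t => F (x + t • v))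
    (hp : ∀ x i, F (x + Pi.single i 1) = F x) (x : Fin n → ℂ) : F x = F 0 := by
  have hline : ∀ x i (t : ℂ), F (x + t • Pi.single i 1) = F x := by
    intro x i t
    have := (hF x (Pi.single i 1)).eq_of_periodic (fun t => by
      rw [add_smul, one_smul, ← add_assoc, hp]) t
    simpa using this
  have hs : ∀ s : Finset (Fin n), F (∑ i ∈ s, x i • Pi.single i (1 : ℂ)) = F 0 := by
    intro s
    induction s using Finset.induction_on with
    | empty => simp
    | insert i s hi ih => rw [Finset.sum_insert hi, add_comm, hline, ih]
  rw [← hs Finset.univ]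
  congr 1
  ext j
  simp [Finset.sum_apply, Pi.single_apply]

/-! ### The coefficients -/

section

variable {n : ℕ}

/-- The vector `δ + M k`. -/
noncomputable def goodArg (M : Matrix (Fin n) (Fin n) ℂ) (δ : Fin n → ℂ) (k : Fin n → ℕ) :
    Fin n → ℂ := δ + M.mulVec fun i => (k i : ℂ)

/-- The matrix whose determinant gives, up to sign, the coefficient in Good's inversion formula. -/
noncomputable def goodMatrix (M : Matrix (Fin n) (Fin n) ℂ) (δ : Fin n → ℂ) (k : Fin n → ℕ) :
    Matrix (Fin n) (Fin n) ℂ :=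
  Matrix.of fun i j => (if i = j then Ring.choose (goodArg M δ k i) (k i) else 0)
    - M i j * choosePred (goodArg M δ k i - 1) (k i)

/-- The coefficient of `r ^ k` in the expansion of `u ^ δ`, where `u i = 1 - r i * ∏ j, u j ^ M j i`,
according to Good's inversion formula. -/
noncomputable def goodCoeff (M : Matrix (Fin n) (Fin n) ℂ) (δ : Fin n → ℂ) (k : Fin n → ℕ) : ℂ :=
  (-1) ^ (∑ j, k j) * (goodMatrix M δ k).det

variable (M : Matrix (Fin n) (Fin n) ℂ)

theorem goodCoeff_polynomial (k : Fin n → ℕ) (x v : Fin n → ℂ) :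
    IsPolynomialFun fun t => goodCoeff M (x + t • v) k := by
  have ha : ∀ i, IsPolynomialFun fun t => goodArg M (x + t • v) k i := by
    intro i
    convert! IsPolynomialFun.linear (x i + M.mulVec (fun i => (k i : ℂ)) i) (v i) using 2
    simp only [goodArg, Pi.add_apply, Pi.smul_apply, smul_eq_mul]
    ring
  refine (IsPolynomialFun.const _).mul (IsPolynomialFun.det fun i j => ?_)
  simp only [goodMatrix, Matrix.of_apply]
  refine IsPolynomialFun.sub ?_
    ((IsPolynomialFun.const _).mul (((ha i).sub (IsPolynomialFun.const 1)).choosePred _))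
  split_ifs
  · exact (ha i).choose _
  · exact IsPolynomialFun.const 0

theorem goodArg_add_single (δ : Fin n → ℂ) (k : Fin n → ℕ) (i : Fin n) :
    goodArg M (δ + Pi.single i 1) k = goodArg M δ k + Pi.single i 1 := by
  simp only [goodArg]
  abel

/-- Thanks to this, the matrices in the recursion below differ in a single row. -/
theorem goodArg_col (δ : Fin n → ℂ) (k : Fin n → ℕ) (i : Fin n) :
    goodArg M (δ + M.col i) k = goodArg M δ (k + Pi.single i 1) := by
  have : (fun j => (((k + Pi.single i 1 : Fin n → ℕ) j : ℕ) : ℂ))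
      = (fun j => (k j : ℂ)) + Pi.single i 1 := by
    ext j
    by_cases h : j = i
    · subst h; simp
    · simp [h]
  simp only [goodArg, this, Matrix.mulVec_add, Matrix.mulVec_single_one]
  abel

/-- For `k i = 0` row `i` of the matrix is a row of the identity, whatever `δ` is, and the other
rows do not involve `δ i`. -/
theorem goodCoeff_add_single_of_eq_zero (δ : Fin n → ℂ) (k : Fin n → ℕ) (i : Fin n)
    (hk : k i = 0) : goodCoeff M (δ + Pi.single i 1) k = goodCoeff M δ k := by
  suffices h : goodMatrix M (δ + Pi.single i 1) k = goodMatrix M δ k by rw [goodCoeff, goodCoeff, h]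
  ext l j
  simp only [goodMatrix, Matrix.of_apply, goodArg_add_single, Pi.add_apply]
  by_cases h : l = i
  · subst h; simp [hk, choosePred]
  · simp [h]

/-- The three matrices agree outside row `i`. In that row Pascal's rule writes the first as the sum
of the other two, and the determinant is linear in a row. -/
theorem goodCoeff_add_single (δ : Fin n → ℂ) (k : Fin n → ℕ) (i : Fin n) :
    goodCoeff M (δ + Pi.single i 1) (k + Pi.single i 1)
      = goodCoeff M δ (k + Pi.single i 1) - goodCoeff M (δ + M.col i) k := by
  have hs : ∑ j, (k + Pi.single i 1 : Fin n → ℕ) j = ∑ j, k j + 1 := by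
    simp [Finset.sum_add_distrib]
  set A := goodMatrix M (δ + M.col i) k with hA
  have h2 : goodMatrix M δ (k + Pi.single i 1)
      = A.updateRow i (goodMatrix M δ (k + Pi.single i 1) i) := by
    ext l j
    by_cases h : l = i
    · subst h; simp
    · rw [Matrix.updateRow_ne h]
      simp [hA, goodMatrix, goodArg_col, h]
  have h1 : goodMatrix M (δ + Pi.single i 1) (k + Pi.single i 1)
      = A.updateRow i (goodMatrix M δ (k + Pi.single i 1) i + A i) := by
    ext l j
    by_cases h : l = i
    · subst h
      have e1 := choose_add_one_eq_add_choosePred (goodArg M δ (k + Pi.single l 1) l) (k l + 1)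
      have e2 := choose_add_one_eq_add_choosePred (goodArg M δ (k + Pi.single l 1) l - 1) (k l)
      simp only [sub_add_cancel] at e2
      simp only [Matrix.updateRow_self, hA, goodMatrix, goodArg_col, goodArg_add_single,
        Matrix.of_apply, Pi.add_apply, Pi.single_eq_same, choosePred, add_sub_cancel_right, e1] at *
      split_ifs <;> linear_combination (-M l j) * e2
    · rw [Matrix.updateRow_ne h]
      simp [hA, goodMatrix, goodArg_col, goodArg_add_single, h]
  have h3 : (goodMatrix M (δ + Pi.single i 1) (k + Pi.single i 1)).det
      = (goodMatrix M δ (k + Pi.single i 1)).det + A.det := by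
    rw [h1, Matrix.det_updateRow_add, ← h2, Matrix.updateRow_eq_self]
  simp only [goodCoeff, hs, pow_succ, h3, ← hA]
  ring

theorem goodCoeff_zero_right (δ : Fin n → ℂ) : goodCoeff M δ 0 = 1 := by
  have : goodMatrix M δ 0 = 1 := by
    ext i j
    simp [goodMatrix, choosePred, Matrix.one_apply]
  simp [goodCoeff, this]

theorem goodCoeff_zero_left {k : Fin n → ℕ} (hk : k ≠ 0) : goodCoeff M 0 k = 0 := by
  have : (goodMatrix M 0 k).det = 0 := by
    -- At `δ = 0` the argument is `M k`, so the absorption identity `natCast_mul_choose` puts the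
    -- nonzero vector `k` in the kernel.
    refine Matrix.exists_mulVec_eq_zero_iff.1 ⟨fun i => (k i : ℂ), fun h => hk ?_, ?_⟩
    · ext i
      simpa using congrFun h i
    · ext i
      have h := natCast_mul_choose (goodArg M 0 k i) (k i)
      have h' : goodArg M 0 k i = ∑ j, M i j * (k j : ℂ) := by
        simp [goodArg, Matrix.mulVec, dotProduct]
      have h2 : ∑ j, M i j * choosePred (goodArg M 0 k i - 1) (k i) * (k j : ℂ)
          = goodArg M 0 k i * choosePred (goodArg M 0 k i - 1) (k i) := by
        conv_rhs => lhs; rw [h']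
        rw [Finset.sum_mul]
        exact Finset.sum_congr rfl fun j _ => by ring
      simp only [Matrix.mulVec, dotProduct, goodMatrix, Matrix.of_apply, sub_mul,
        Finset.sum_sub_distrib, ite_mul, zero_mul, Finset.sum_ite_eq, Finset.mem_univ, if_true,
        Pi.zero_apply, h2]
      rw [← h]
      ring
  rw [goodCoeff, this, mul_zero]

theorem continuous_goodCoeff (k : Fin n → ℕ) : Continuous fun δ => goodCoeff M δ k := by
  have ha : ∀ i, Continuous fun δ => goodArg M δ k i := fun i => by
    simp only [goodArg, Pi.add_apply]
    fun_prop
  have hc : ∀ m : ℕ, Continuous fun x : ℂ => Ring.choose x m := fun m => by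
    simp only [Ring.choose_eq_prod_div]
    fun_prop
  have hc' : ∀ m : ℕ, Continuous fun x : ℂ => choosePred x m := by
    rintro (_ | m)
    · exact continuous_const
    · exact hc m
  refine continuous_const.mul (Continuous.matrix_det ?_)
  refine continuous_matrix fun i j => ?_
  simp only [goodMatrix, Matrix.of_apply]
  refine Continuous.sub ?_ (continuous_const.mul ((hc' _).comp ((ha i).sub continuous_const)))
  split_ifs
  · exact (hc _).comp (ha i)
  · exact continuous_const

/-! ### The Gamma function form of the coefficients -/

theorem Gamma_div_Gamma_sub_natCast_add_one {a : ℂ} (ha : ∀ m : ℕ, a ≠ -m) (k : ℕ) :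
    Complex.Gamma a / Complex.Gamma (a - k + 1) = k.factorial * Ring.choose a k / a := by
  have h0 : a ≠ 0 := by simpa using ha 0
  have hG := Complex.Gamma_ne_zero ha
  -- The recurrence of `1 / Γ` has no exceptions, so `a - k + 1` may be a pole of `Γ`; there the
  -- convention `0⁻¹ = 0` gives the true value.
  have key : ∀ k : ℕ, (Complex.Gamma (a - k + 1))⁻¹
      = (∏ j ∈ Finset.range k, (a - j)) * (Complex.Gamma (a + 1))⁻¹ := by
    intro k
    induction k with
    | zero => simp
    | succ k ih =>
      have h := Complex.one_div_Gamma_eq_self_mul_one_div_Gamma_add_one (a - k)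
      rw [ih] at h
      have e : a - ((k + 1 : ℕ) : ℂ) + 1 = a - k := by push_cast; ring
      rw [e, h, Finset.prod_range_succ]
      ring
  have hk : (k.factorial : ℂ) ≠ 0 := by exact_mod_cast k.factorial_ne_zero
  rw [div_eq_mul_inv, key, Complex.Gamma_add_one a h0, Ring.choose_eq_prod_div]
  field_simp

/-- Extracting row factors leaves `diag a - K M`, with `K = diag k`. The order of `K` and `M` is
reversed by `det (1 - D M) = det (1 - M D)` with `D = diag (k / a)`. -/
theorem goodMatrix_det_eq {δ : Fin n → ℂ} {k : Fin n → ℕ} (h : ∀ i, goodArg M δ k i ≠ 0) :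
    (goodMatrix M δ k).det = (∏ i, Ring.choose (goodArg M δ k i) (k i) / goodArg M δ k i)
      * (Matrix.diagonal (goodArg M δ k) - M * Matrix.diagonal fun i => (k i : ℂ)).det := by
  set a := goodArg M δ k with ha
  set K := Matrix.diagonal fun i => (k i : ℂ) with hK
  set D := Matrix.diagonal fun i => (a i)⁻¹ * (k i : ℂ) with hD
  have e1 : goodMatrix M δ k = Matrix.of fun i j =>
      (Ring.choose (a i) (k i) / a i) * (Matrix.diagonal a - K * M) i j := by
    ext i j
    have h1 := natCast_mul_choose (a i) (k i)
    have h2 : choosePred (a i - 1) (k i) = (k i : ℂ) * Ring.choose (a i) (k i) / a i := by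
      rw [h1, mul_div_cancel_left₀ _ (h i)]
    simp only [goodMatrix, Matrix.of_apply, ← ha, hK, h2, Matrix.sub_apply, Matrix.diagonal_apply,
      Matrix.diagonal_mul]
    have := h i
    split_ifs <;> field_simp
    ring
  have e2 : Matrix.diagonal a - K * M = Matrix.diagonal a * (1 - D * M) := by
    rw [mul_sub, mul_one, ← mul_assoc, hD, hK, Matrix.diagonal_mul_diagonal]
    congr 3
    ext i
    rw [mul_inv_cancel_left₀ (h i)]
  have e3 : Matrix.diagonal a - M * K = (1 - M * D) * Matrix.diagonal a := by
    rw [sub_mul, one_mul, mul_assoc, hD, hK, Matrix.diagonal_mul_diagonal]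
    congr 3
    ext i
    field_simp [h i]
  rw [e1, Matrix.det_mul_column, e2, e3, Matrix.det_mul, Matrix.det_mul,
    Matrix.det_one_sub_mul_comm, mul_comm (Matrix.det _) (Matrix.det _)]

theorem coeffFormula_eq_goodCoeff {κ B : Matrix (Fin n) (Fin n) ℂ} {d : Fin n → ℂ}
    {k : Fin n → ℕ} (h : d ∈ regularSet κ B k) :
    coeffFormula κ B d k = goodCoeff (κ⁻¹ * B) (κ⁻¹.mulVec d) k := by
  have ha : gammaArg κ B d k = goodArg (κ⁻¹ * B) (κ⁻¹.mulVec d) k := rfl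
  have h' : ∀ i (m : ℕ), goodArg (κ⁻¹ * B) (κ⁻¹.mulVec d) k i ≠ -m := h
  rw [goodCoeff, goodMatrix_det_eq _ fun i => by simpa using h' i 0]
  simp only [coeffFormula, detFactor, ha]
  rw [← Finset.prod_div_distrib,
    Finset.prod_congr rfl fun i _ => Gamma_div_Gamma_sub_natCast_add_one (h' i) (k i)]
  simp only [mul_div_assoc, Finset.prod_mul_distrib]
  have : ∏ i, ((k i).factorial : ℂ) ≠ 0 :=
    Finset.prod_ne_zero_iff.2 fun i _ => by exact_mod_cast (k i).factorial_ne_zero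
  field_simp

/-- `goodCoeff` is continuous in `d` everywhere, so it supplies the removed singularities. -/
theorem isCoeffValue_goodCoeff (κ B : Matrix (Fin n) (Fin n) ℂ) (d : Fin n → ℂ)
    (k : Fin n → ℕ) : IsCoeffValue κ B d k (goodCoeff (κ⁻¹ * B) (κ⁻¹.mulVec d) k) := by
  have hc : Continuous fun d => goodCoeff (κ⁻¹ * B) (κ⁻¹.mulVec d) k :=
    (continuous_goodCoeff _ k).comp (by fun_prop)
  refine (hc.continuousAt.tendsto.mono_left nhdsWithin_le_nhds).congr' ?_
  filter_upwards [self_mem_nhdsWithin] with d' hd'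
  exact (coeffFormula_eq_goodCoeff hd').symm

/-! ### The generating power series -/

/-- A family of power series with coefficients polynomial along lines, which satisfies the
functional equation of the powers `u ^ δ` and vanishes at `δ = 0`, is zero. -/
theorem MvPowerSeries.eq_zero_of_functional_equation
    {D : (Fin n → ℂ) → MvPowerSeries (Fin n) ℂ}
    (hpoly : ∀ k x v, IsPolynomialFun fun t => MvPowerSeries.coeff k (D (x + t • v)))
    (hD : ∀ δ i, D (δ + Pi.single i 1) = D δ - MvPowerSeries.X i * D (δ + M.col i))
    (h0 : D 0 = 0) (δ : Fin n → ℂ) : D δ = 0 := by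
  suffices h : ∀ (m : ℕ) (k : Fin n →₀ ℕ), k.degree = m → ∀ δ, MvPowerSeries.coeff k (D δ) = 0 by
    ext k
    exact h _ k rfl δ
  intro m
  induction m with
  | zero =>
    intro k hk δ
    obtain rfl : k = 0 := (Finsupp.degree_eq_zero_iff k).1 hk
    rw [eq_apply_zero_of_periodic (F := fun δ => MvPowerSeries.coeff 0 (D δ)) (hpoly 0)
      (fun x i => by simp [hD]) δ, h0, map_zero]
  | succ m ih =>
    intro k hk δ
    rw [eq_apply_zero_of_periodic (F := fun δ => MvPowerSeries.coeff k (D δ)) (hpoly k)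
      (fun x i => ?_) δ, h0, map_zero]
    -- The factor `X i` lowers the degree, so the last term dies by induction and the coefficient is
    -- periodic.
    rw [hD, map_sub, sub_eq_self]
    by_cases hi : Finsupp.single i 1 ≤ k
    · obtain ⟨l, rfl⟩ := exists_add_of_le hi
      rw [MvPowerSeries.X, MvPowerSeries.coeff_add_monomial_mul, one_mul]
      refine ih l ?_ _
      rw [map_add, Finsupp.degree_single] at hk
      omega
    · rw [MvPowerSeries.X, MvPowerSeries.coeff_monomial_mul, if_neg hi]

/-- The formal power series whose coefficients are given by Good's inversion formula. -/
noncomputable def goodSeries (δ : Fin n → ℂ) : MvPowerSeries (Fin n) ℂ :=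
  fun k => goodCoeff M δ k

theorem coeff_goodSeries (δ : Fin n → ℂ) (k : Fin n →₀ ℕ) :
    MvPowerSeries.coeff k (goodSeries M δ) = goodCoeff M δ k := rfl

theorem goodSeries_zero : goodSeries M 0 = 1 := by
  ext k
  rw [coeff_goodSeries, MvPowerSeries.coeff_one]
  split_ifs with h
  · rw [h, Finsupp.coe_zero, goodCoeff_zero_right]
  · exact goodCoeff_zero_left M fun h' => h (DFunLike.coe_injective h')

theorem goodSeries_add_single (δ : Fin n → ℂ) (i : Fin n) :
    goodSeries M (δ + Pi.single i 1)
      = goodSeries M δ - MvPowerSeries.X i * goodSeries M (δ + M.col i) := by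
  ext k
  rw [map_sub]
  by_cases hi : Finsupp.single i 1 ≤ k
  · obtain ⟨l, rfl⟩ := exists_add_of_le hi
    rw [MvPowerSeries.X, MvPowerSeries.coeff_add_monomial_mul, one_mul]
    simp only [coeff_goodSeries, add_comm (Finsupp.single i 1), Finsupp.coe_add,
      Finsupp.single_eq_pi_single]
    exact goodCoeff_add_single M δ l i
  · rw [MvPowerSeries.X, MvPowerSeries.coeff_monomial_mul, if_neg hi, sub_zero]
    refine goodCoeff_add_single_of_eq_zero M δ k i ?_
    rw [Finsupp.single_le_iff] at hi
    omega

/-- For fixed `δ'`, both sides satisfy the same functional equation in `δ` and agree at `δ = 0`. -/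
theorem goodSeries_add (δ δ' : Fin n → ℂ) :
    goodSeries M (δ + δ') = goodSeries M δ * goodSeries M δ' := by
  rw [← sub_eq_zero]
  refine MvPowerSeries.eq_zero_of_functional_equation M
    (D := fun δ => goodSeries M (δ + δ') - goodSeries M δ * goodSeries M δ') ?_ ?_ ?_ δ
  · intro k x v
    simp only [map_sub, MvPowerSeries.coeff_mul, coeff_goodSeries, add_right_comm x _ δ']
    exact (goodCoeff_polynomial M _ _ _).sub
      (.sum _ fun p _ => (goodCoeff_polynomial M _ _ _).mul (.const _))
  · intro δ i
    simp only [add_right_comm δ _ δ', goodSeries_add_single]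
    ring
  · simp [goodSeries_zero]

/-! ### Convergence -/

theorem norm_choose_le (x : ℂ) (k : ℕ) : ‖Ring.choose x k‖ ≤ Real.exp (‖x‖ + k) := by
  rw [Ring.choose_eq_prod_div, norm_div, norm_prod, Complex.norm_natCast]
  refine le_trans ?_ (Real.pow_div_factorial_le_exp (‖x‖ + k) (by positivity) k)
  gcongr
  calc ∏ j ∈ Finset.range k, ‖x - j‖ ≤ ∏ _j ∈ Finset.range k, (‖x‖ + k) := by
        refine Finset.prod_le_prod (fun _ _ => norm_nonneg _) fun j hj => ?_
        refine (norm_sub_le _ _).trans ?_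
        rw [Complex.norm_natCast]
        gcongr
        exact (Finset.mem_range.1 hj).le
    _ = (‖x‖ + k) ^ k := by simp

theorem norm_choosePred_le (x : ℂ) (k : ℕ) : ‖choosePred x k‖ ≤ Real.exp (‖x‖ + k) := by
  cases k with
  | zero => simpa [choosePred] using (Real.exp_pos _).le
  | succ k =>
    refine (norm_choose_le x k).trans ?_
    gcongr
    omega

/-- Exponential bound of the coefficients, locally uniform in the exponent. -/
theorem exists_norm_goodCoeff_le (R : ℝ) : ∃ C D : ℝ, 0 ≤ C ∧ 0 < D ∧
    ∀ δ : Fin n → ℂ, ‖δ‖ ≤ R → ∀ k : Fin n → ℕ, ‖goodCoeff M δ k‖ ≤ C * D ^ (∑ i, k i) := by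
  obtain ⟨m, hm0, hm⟩ : ∃ m : ℝ, 0 ≤ m ∧ ∀ i j, ‖M i j‖ ≤ m := by
    refine ⟨∑ i, ∑ j, ‖M i j‖, by positivity, fun i j => ?_⟩
    exact (Finset.single_le_sum (f := fun j => ‖M i j‖) (fun _ _ => norm_nonneg _)
      (Finset.mem_univ j)).trans (Finset.single_le_sum (f := fun i => ∑ j, ‖M i j‖)
      (fun _ _ => by positivity) (Finset.mem_univ i))
  -- Each entry is at most `c * e ^ |k|`; the Leibniz expansion has `n!` products of `n` entries.
  set c := (1 + m) * Real.exp (R + 1) with hc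
  set e := Real.exp (m + 1) with he
  refine ⟨n.factorial * c ^ n, e ^ n, by positivity, by positivity, fun δ hδ k => ?_⟩
  set s := ∑ i, k i with hs
  have ha : ∀ i, ‖goodArg M δ k i‖ ≤ R + m * s := by
    intro i
    refine (norm_add_le (δ i) _).trans (add_le_add ((norm_le_pi_norm δ i).trans hδ) ?_)
    change ‖∑ j, M i j * (k j : ℂ)‖ ≤ _
    refine (norm_sum_le _ _).trans ?_
    rw [hs, Nat.cast_sum, Finset.mul_sum]
    refine Finset.sum_le_sum fun j _ => ?_
    rw [norm_mul, Complex.norm_natCast]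
    gcongr
    exact hm i j
  have hk : ∀ i, (k i : ℝ) ≤ s := fun i => by
    exact_mod_cast Finset.single_le_sum (f := k) (fun _ _ => Nat.zero_le _) (Finset.mem_univ i)
  have hE : Real.exp (R + 1) * e ^ s = Real.exp (R + m * s + 1 + s) := by
    rw [he, ← Real.exp_nat_mul, ← Real.exp_add]
    ring_nf
  have hentry : ∀ i j, ‖goodMatrix M δ k i j‖ ≤ c * e ^ s := by
    intro i j
    have h1 : ‖Ring.choose (goodArg M δ k i) (k i)‖ ≤ Real.exp (R + m * s + 1 + s) := by
      refine (norm_choose_le _ _).trans (Real.exp_le_exp.2 ?_)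
      linarith [ha i, hk i]
    have h2 : ‖choosePred (goodArg M δ k i - 1) (k i)‖ ≤ Real.exp (R + m * s + 1 + s) := by
      refine (norm_choosePred_le _ _).trans (Real.exp_le_exp.2 ?_)
      have := norm_sub_le (goodArg M δ k i) 1
      rw [norm_one] at this
      linarith [ha i, hk i]
    rw [hc, mul_assoc, hE, add_mul, one_mul]
    simp only [goodMatrix, Matrix.of_apply]
    refine (norm_sub_le _ _).trans (add_le_add ?_ ?_)
    · split_ifs
      · exact h1
      · rw [norm_zero]; positivity
    · rw [norm_mul]
      gcongr
      exact hm i j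
  have hdet := Matrix.det_le (abv := IsAbsoluteValue.toAbsoluteValue (norm : ℂ → ℝ)) hentry
  rw [Fintype.card_fin, nsmul_eq_mul] at hdet
  rw [goodCoeff, norm_mul, norm_pow, norm_neg, norm_one, one_pow, one_mul]
  refine hdet.trans (le_of_eq ?_)
  rw [mul_pow, ← pow_mul, ← pow_mul, mul_comm s n, mul_assoc]

theorem summable_pow_sum {q : ℝ} (hq0 : 0 ≤ q) (hq : q < 1) (n : ℕ) :
    Summable fun k : Fin n → ℕ => q ^ (∑ i, k i) := by
  induction n with
  | zero => exact (hasSum_fintype _).summable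
  | succ n ih =>
    rw [← (Fin.consEquiv fun _ : Fin (n + 1) => ℕ).summable_iff]
    refine ((summable_geometric_of_lt_one hq0 hq).mul_of_nonneg ih (fun _ => by positivity)
      (fun _ => by positivity)).congr fun p => ?_
    simp [Fin.consEquiv, Fin.sum_univ_succ, pow_add]

/-! ### The sum of the series -/

/-- The sum of the power series `goodSeries M δ` at `r`. -/
noncomputable def goodSum (δ r : Fin n → ℂ) : ℂ := ∑' k : Fin n → ℕ, goodCoeff M δ k * ∏ i, r i ^ k i

theorem norm_prod_pow_le {r : Fin n → ℂ} {ρ : ℝ} (hr : ‖r‖ ≤ ρ) (k : Fin n → ℕ) :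
    ‖∏ i, r i ^ k i‖ ≤ ρ ^ (∑ i, k i) := by
  rw [norm_prod, ← Finset.prod_pow_eq_pow_sum]
  refine Finset.prod_le_prod (fun _ _ => norm_nonneg _) fun i _ => ?_
  rw [norm_pow]
  gcongr
  exact (norm_le_pi_norm r i).trans hr

/-- On a polydisc around the origin, the series is dominated by a summable sequence, uniformly for
bounded exponents. -/
theorem exists_summable_bound (R : ℝ) : ∃ ρ > 0, ∃ b : (Fin n → ℕ) → ℝ, Summable b ∧
    ∀ δ r : Fin n → ℂ, ‖δ‖ ≤ R → ‖r‖ ≤ ρ → ∀ k, ‖goodCoeff M δ k * ∏ i, r i ^ k i‖ ≤ b k := by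
  obtain ⟨C, D, hC, hD, h⟩ := exists_norm_goodCoeff_le M R
  refine ⟨(2 * D)⁻¹, by positivity, fun k => C * (2⁻¹ : ℝ) ^ (∑ i, k i),
    (summable_pow_sum (by norm_num) (by norm_num) n).mul_left C, fun δ r hδ hr k => ?_⟩
  rw [norm_mul]
  calc _ ≤ C * D ^ (∑ i, k i) * (2 * D)⁻¹ ^ (∑ i, k i) := by
        gcongr
        · exact h δ hδ k
        · exact norm_prod_pow_le hr k
    _ = _ := by
        rw [mul_assoc, ← mul_pow, mul_inv, mul_left_comm, mul_inv_cancel₀ hD.ne', mul_one]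

/-- The points at which the series with the exponent `δ` is absolutely convergent. -/
def GoodSummable (δ r : Fin n → ℂ) : Prop :=
  Summable fun k : Fin n → ℕ => ‖goodCoeff M δ k * ∏ i, r i ^ k i‖

variable {M}

theorem GoodSummable.hasSum {δ r : Fin n → ℂ} (h : GoodSummable M δ r) :
    HasSum (fun k : Fin n → ℕ => goodCoeff M δ k * ∏ i, r i ^ k i) (goodSum M δ r) :=
  (Summable.of_norm h).hasSum

theorem goodSum_add {δ δ' r : Fin n → ℂ} (h : GoodSummable M δ r) (h' : GoodSummable M δ' r) :
    goodSum M (δ + δ') r = goodSum M δ r * goodSum M δ' r := by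
  -- Finitely supported indices give access to the antidiagonals of the Cauchy product.
  have he : ∀ δ, goodSum M δ r = ∑' k : Fin n →₀ ℕ, goodCoeff M δ k * ∏ i, r i ^ k i := fun δ =>
    (Finsupp.equivFunOnFinite.tsum_eq
      (fun k : Fin n → ℕ => goodCoeff M δ k * ∏ i, r i ^ k i)).symm
  have hs : ∀ {δ}, GoodSummable M δ r →
      Summable fun k : Fin n →₀ ℕ => ‖goodCoeff M δ k * ∏ i, r i ^ k i‖ := fun h =>
    (Finsupp.equivFunOnFinite.summable_iff).2 h
  have hprod := summable_mul_of_summable_norm (hs h) (hs h')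
  rw [he, he, he, (hs h).of_norm.tsum_mul_tsum_eq_tsum_sum_antidiagonal (hs h').of_norm hprod]
  refine tsum_congr fun k => ?_
  rw [← coeff_goodSeries, goodSeries_add, MvPowerSeries.coeff_mul, Finset.sum_mul]
  refine Finset.sum_congr rfl fun p hp => ?_
  rw [← Finset.HasAntidiagonal.mem_antidiagonal.1 hp]
  simp only [coeff_goodSeries, Finsupp.coe_add, Pi.add_apply, pow_add, Finset.prod_mul_distrib]
  ring

theorem goodSum_zero_left (r : Fin n → ℂ) : goodSum M 0 r = 1 := by
  rw [goodSum, tsum_eq_single 0 fun k hk => by rw [goodCoeff_zero_left M hk, zero_mul]]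
  simp [goodCoeff_zero_right]

theorem goodSum_zero_right (δ : Fin n → ℂ) : goodSum M δ 0 = 1 := by
  rw [goodSum, tsum_eq_single 0 fun k hk => ?_]
  · simp [goodCoeff_zero_right]
  · obtain ⟨i, hi⟩ := Function.ne_iff.1 hk
    rw [Finset.prod_eq_zero (Finset.mem_univ i) (by simpa using hi), mul_zero]

/-- This is the equation `u i = 1 - r i * u ^ (M e_i)`, the recursion at `δ = 0` after summation. -/
theorem goodSum_single {r : Fin n → ℂ} (i : Fin n) (h : GoodSummable M (M.col i) r)
    (h1 : GoodSummable M (Pi.single i 1) r) :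
    goodSum M (Pi.single i 1) r = 1 - r i * goodSum M (M.col i) r := by
  have hinj : Function.Injective fun k : Fin n → ℕ => k + Pi.single i 1 := add_left_injective _
  have hcoef : ∀ k : Fin n → ℕ, goodCoeff M (Pi.single i 1) (k + Pi.single i 1)
      = - goodCoeff M (M.col i) k := by
    intro k
    have hne : k + Pi.single i 1 ≠ 0 := fun h => by simpa using congrFun h i
    simpa [goodCoeff_zero_left M hne] using goodCoeff_add_single M 0 k i
  have hA : HasSum (fun k : Fin n → ℕ =>
      goodCoeff M (Pi.single i 1) k * (∏ i, r i ^ k i) - if k = 0 then 1 else 0)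
      (goodSum M (Pi.single i 1) r - 1) := h1.hasSum.sub (hasSum_ite_eq 0 1)
  -- Outside the range of `k ↦ k + e_i` one has `k i = 0`, where the coefficients are those of the
  -- constant `1`.
  rw [← hinj.hasSum_iff] at hA
  · have hB := (h.hasSum.mul_left (-r i))
    have := hA.unique (hB.congr_fun ?_)
    · linear_combination this
    · intro k
      have hne : k + Pi.single i 1 ≠ 0 := fun h => by simpa using congrFun h i
      have hp : ∏ j, r j ^ (k + Pi.single i 1 : Fin n → ℕ) j = r i * ∏ j, r j ^ k j := by
        simp only [Pi.add_apply, pow_add, Finset.prod_mul_distrib]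
        rw [mul_comm, Finset.prod_eq_single i (fun j _ hj => by simp [hj]) (by simp)]
        simp
      simp only [Function.comp_apply, hcoef, hp, if_neg hne]
      ring
  · intro k hk
    have hki : k i = 0 := by
      by_contra hki
      refine hk ⟨k - Pi.single i 1, ?_⟩
      ext j
      by_cases hj : j = i
      · subst hj; simp; omega
      · simp [hj]
    have := goodCoeff_add_single_of_eq_zero M 0 k i hki
    rw [zero_add] at this
    rw [this]
    split_ifs with h0
    · subst h0; simp [goodCoeff_zero_right]
    · simp [goodCoeff_zero_left M h0]

variable (M)

theorem eventually_goodSummable (R : ℝ) :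
    ∀ᶠ r in 𝓝 (0 : Fin n → ℂ), ∀ δ, ‖δ‖ ≤ R → GoodSummable M δ r := by
  obtain ⟨ρ, hρ, b, hb, h⟩ := exists_summable_bound M R
  filter_upwards [Metric.closedBall_mem_nhds _ hρ] with r hr δ hδ
  rw [mem_closedBall_zero_iff] at hr
  exact Summable.of_nonneg_of_le (fun _ => norm_nonneg _) (h δ r hδ hr) hb

/-- For `r` near the origin the sum is close to `1`, uniformly for bounded exponents. -/
theorem eventually_norm_goodSum_sub_one_lt (R : ℝ) {ε : ℝ} (hε : 0 < ε) :
    ∀ᶠ r in 𝓝 (0 : Fin n → ℂ), ∀ δ, ‖δ‖ ≤ R → ‖goodSum M δ r - 1‖ < ε := by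
  -- The margin `R + 1` makes the ball of radius `R` interior to the domain of joint continuity;
  -- compactness then gives uniformity in `δ`.
  obtain ⟨ρ, hρ, b, hb, h⟩ := exists_summable_bound M (R + 1)
  have hu : TendstoUniformlyOn (fun (t : Finset (Fin n → ℕ)) (p : (Fin n → ℂ) × (Fin n → ℂ)) =>
      ∑ k ∈ t, goodCoeff M p.1 k * ∏ i, p.2 i ^ k i)
      (fun p => goodSum M p.1 p.2) atTop (Metric.closedBall 0 (R + 1) ×ˢ Metric.closedBall 0 ρ) :=
    tendstoUniformlyOn_tsum hb fun k p hp =>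
      h p.1 p.2 (mem_closedBall_zero_iff.1 hp.1) (mem_closedBall_zero_iff.1 hp.2) k
  have hc : ContinuousOn (fun p : (Fin n → ℂ) × (Fin n → ℂ) => goodSum M p.1 p.2)
      (Metric.closedBall 0 (R + 1) ×ˢ Metric.closedBall 0 ρ) := by
    refine hu.continuousOn (Frequently.of_forall fun t => Continuous.continuousOn ?_)
    refine continuous_finsetSum _ fun k _ => ?_
    exact ((continuous_goodCoeff M k).comp continuous_fst).mul (by fun_prop)
  have hK : IsCompact (Metric.closedBall (0 : Fin n → ℂ) R) := isCompact_closedBall 0 R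
  have := hK.eventually_forall_of_forall_eventually (x₀ := (0 : Fin n → ℂ))
    (P := fun r δ => ‖goodSum M δ r - 1‖ < ε) fun δ hδ => ?_
  · filter_upwards [this] with r hr δ hδ using hr δ (mem_closedBall_zero_iff.2 hδ)
  · have hmem : Metric.closedBall (0 : Fin n → ℂ) (R + 1) ×ˢ Metric.closedBall (0 : Fin n → ℂ) ρ
        ∈ 𝓝 (δ, (0 : Fin n → ℂ)) := by
      refine prod_mem_nhds ?_ (Metric.closedBall_mem_nhds _ hρ)
      refine Metric.closedBall_mem_nhds_of_mem (mem_ball_zero_iff.2 ?_)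
      linarith [mem_closedBall_zero_iff.1 hδ]
    have hcont : ContinuousAt (fun p : (Fin n → ℂ) × (Fin n → ℂ) => ‖goodSum M p.1 p.2 - 1‖)
        (δ, 0) := ((hc.continuousAt hmem).sub continuousAt_const).norm
    have hev : ∀ᶠ p in 𝓝 (δ, (0 : Fin n → ℂ)), ‖goodSum M p.1 p.2 - 1‖ < ε :=
      hcont.eventually_lt continuousAt_const (by simpa [goodSum_zero_right] using hε)
    exact (continuous_swap.tendsto ((0 : Fin n → ℂ), δ)).eventually hev

/-- The sum is a holomorphic function of the exponent along lines. -/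
theorem differentiableOn_goodSum {R : ℝ} {r : Fin n → ℂ} {b : (Fin n → ℕ) → ℝ} (hb : Summable b)
    (h : ∀ δ : Fin n → ℂ, ‖δ‖ ≤ R → ∀ k, ‖goodCoeff M δ k * ∏ i, r i ^ k i‖ ≤ b k)
    (δ : Fin n → ℂ) {T : ℝ} (hT : T * ‖δ‖ ≤ R) :
    DifferentiableOn ℂ (fun t : ℂ => goodSum M (t • δ) r) (Metric.ball 0 T) := by
  refine Complex.differentiableOn_tsum_of_summable_norm hb (fun k => ?_) Metric.isOpen_ball
    fun k t ht => h _ ?_ k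
  · have := (goodCoeff_polynomial M k 0 δ).differentiable
    simp only [zero_add] at this
    exact (this.mul_const _).differentiableOn
  · rw [norm_smul]
    refine le_trans ?_ hT
    gcongr
    exact (mem_ball_zero_iff.1 ht).le

/-! ### Powers of the sum -/

/-- A holomorphic function near `1` on a disc around `0` that takes sums to products is given by
powers. -/
theorem eq_cpow_of_map_add {f : ℂ → ℂ} {T : ℝ} (hT : 1 < T)
    (hd : DifferentiableOn ℂ f (Metric.ball 0 T))
    (hadd : ∀ s ∈ Metric.ball (0 : ℂ) T, ∀ t ∈ Metric.ball (0 : ℂ) T, f (s + t) = f s * f t)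
    (h1 : ∀ t ∈ Metric.ball (0 : ℂ) T, ‖f t - 1‖ < 1) {t : ℂ} (ht : t ∈ Metric.ball 0 T) :
    f t = f 1 ^ t := by
  have h0T : (0 : ℂ) ∈ Metric.ball 0 T := by simp; linarith
  have h1T : (1 : ℂ) ∈ Metric.ball 0 T := by simpa using hT
  have hslit : ∀ t ∈ Metric.ball (0 : ℂ) T, f t ∈ Complex.slitPlane := fun t ht =>
    Complex.ball_one_subset_slitPlane (by simpa [dist_eq_norm] using h1 t ht)
  have hne : ∀ t ∈ Metric.ball (0 : ℂ) T, f t ≠ 0 := fun t ht =>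
    Complex.slitPlane_ne_zero (hslit t ht)
  have hf0 : f 0 = 1 := by
    have := hadd 0 h0T 0 h0T
    rw [add_zero] at this
    exact (mul_eq_left₀ (hne 0 h0T)).1 this.symm
  -- Additivity yields `f' = f'(0) f`, so `log f(t) - t f'(0)` is constant; values near `1` keep the
  -- principal logarithm holomorphic.
  have hderiv : ∀ t ∈ Metric.ball (0 : ℂ) T, HasDerivAt f (f t * deriv f 0) t := by
    intro t ht
    have h := (hd.differentiableAt (Metric.isOpen_ball.mem_nhds h0T)).hasDerivAt
    rw [← sub_self t] at h
    have h2 := (h.comp_sub_const t t).const_mul (f t)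
    rw [sub_self] at h2
    refine h2.congr_of_eventuallyEq ?_
    filter_upwards [Metric.ball_mem_nhds t (zero_lt_one.trans hT)] with x hx
    rw [← hadd t ht (x - t) (by simpa [dist_eq_norm] using hx), add_sub_cancel]
  set g := fun t => Complex.log (f t) - t * deriv f 0 with hg
  have hgd : ∀ t ∈ Metric.ball (0 : ℂ) T, HasDerivAt g 0 t := by
    intro t ht
    convert! ((hderiv t ht).clog (hslit t ht)).sub ((hasDerivAt_id t).mul_const (deriv f 0)) using 1
    rw [mul_div_cancel_left₀ _ (hne t ht), one_mul, sub_self]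
  have hconst : ∀ t ∈ Metric.ball (0 : ℂ) T, g t = 0 := by
    intro t ht
    have : g t = g 0 := Metric.isOpen_ball.is_const_of_deriv_eq_zero
      (convex_ball (0 : ℂ) T).isPreconnected
      (fun x hx => (hgd x hx).differentiableAt.differentiableWithinAt)
      (fun x hx => (hgd x hx).deriv) ht h0T
    rw [this]
    simp [hg, hf0]
  have e1 := hconst 1 h1T
  have et := hconst t ht
  rw [Complex.cpow_def_of_ne_zero (hne 1 h1T), ← Complex.exp_log (hne t ht)]
  congr 1
  simp only [hg] at e1 et
  linear_combination et - t * e1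

theorem eventually_goodSum_smul (R T : ℝ) (hT : 1 < T) :
    ∀ᶠ r in 𝓝 (0 : Fin n → ℂ), ∀ δ, ‖δ‖ ≤ R → ∀ t : ℂ, ‖t‖ < T →
      goodSum M (t • δ) r = goodSum M δ r ^ t := by
  obtain ⟨ρ, hρ, b, hb, h⟩ := exists_summable_bound M (T * R)
  filter_upwards [Metric.closedBall_mem_nhds _ hρ, eventually_goodSummable M (T * R),
    eventually_norm_goodSum_sub_one_lt M (T * R) one_pos] with r hr hs h1 δ hδ t ht
  rw [mem_closedBall_zero_iff] at hr
  have hle : ∀ t ∈ Metric.ball (0 : ℂ) T, ‖t • δ‖ ≤ T * R := fun t ht => by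
    rw [norm_smul]
    exact mul_le_mul (mem_ball_zero_iff.1 ht).le hδ (norm_nonneg _) (by linarith)
  have := eq_cpow_of_map_add (f := fun t => goodSum M (t • δ) r) hT
    (differentiableOn_goodSum M hb (fun δ hδ => h δ r hδ hr) δ
      (mul_le_mul_of_nonneg_left hδ (by linarith)))
    -- Here `s + t` may leave the disc: only the two factors need to be summable.
    (fun s hs' t ht' => by
      simpa only [add_smul] using goodSum_add (hs _ (hle s hs')) (hs _ (hle t ht')))
    (fun t ht => h1 _ (hle t ht)) (mem_ball_zero_iff.2 ht)
  simpa only [one_smul] using this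

theorem goodSum_sum {ι : Type*} {R : ℝ} {r : Fin n → ℂ}
    (h : ∀ δ, ‖δ‖ ≤ R → GoodSummable M δ r) (s : Finset ι) (δ : ι → Fin n → ℂ)
    (hs : ∑ i ∈ s, ‖δ i‖ ≤ R) : goodSum M (∑ i ∈ s, δ i) r = ∏ i ∈ s, goodSum M (δ i) r := by
  classical
  induction s using Finset.induction_on with
  | empty => simp [goodSum_zero_left]
  | insert i s hi ih =>
    rw [Finset.sum_insert hi] at hs
    have h0 : 0 ≤ ∑ i ∈ s, ‖δ i‖ := by positivity
    have h1 := norm_nonneg (δ i)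
    rw [Finset.sum_insert hi, Finset.prod_insert hi,
      goodSum_add (h _ (by linarith)) (h _ ((norm_sum_le _ _).trans (by linarith))),
      ih (by linarith)]

theorem eventually_goodSum_mulVec (K : Matrix (Fin n) (Fin n) ℂ) (d : Fin n → ℂ) :
    ∀ᶠ r in 𝓝 (0 : Fin n → ℂ),
      goodSum M (K.mulVec d) r = ∏ j, goodSum M (K.col j) r ^ d j := by
  filter_upwards [eventually_goodSummable M (∑ j, ‖d j • K.col j‖),
    -- The summand `2` ensures both `1 < T` and `‖d j‖ < T`, even for `d = 0`.
    eventually_goodSum_smul M (∑ j, ‖K.col j‖) (∑ j, ‖d j‖ + 2)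
      (by have : 0 ≤ ∑ j, ‖d j‖ := by positivity
          linarith)] with r hs hp
  have e : K.mulVec d = ∑ j, d j • K.col j := by
    ext i
    simp [Matrix.mulVec, dotProduct, Finset.sum_apply, mul_comm]
  rw [e, goodSum_sum M hs _ _ le_rfl]
  refine Finset.prod_congr rfl fun j _ => hp _ ?_ _ ?_
  · exact Finset.single_le_sum (f := fun j => ‖K.col j‖) (fun _ _ => norm_nonneg _)
      (Finset.mem_univ j)
  · have := Finset.single_le_sum (f := fun j => ‖d j‖) (fun _ _ => norm_nonneg _)
      (Finset.mem_univ j)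
    linarith

/-! ### The trinomial system -/

variable (β μ ν : Fin n → Fin n → ℤ)

/-- The left-hand sides of the trinomial system, as functions of `(r, y)`. -/
noncomputable def trinomialMap (p : (Fin n → ℂ) × (Fin n → ℂ)) : Fin n → ℂ := fun i =>
  p.1 i * laurentMonomial (β i) p.2 + laurentMonomial (μ i) p.2 - laurentMonomial (ν i) p.2

theorem laurentMonomial_one (α : Fin n → ℤ) : laurentMonomial α 1 = 1 := by
  simp [laurentMonomial]

theorem trinomialMap_zero_one : trinomialMap β μ ν (0, 1) = 0 := by
  ext i
  simp [trinomialMap, laurentMonomial_one]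

theorem analyticAt_laurentMonomial (α : Fin n → ℤ) : AnalyticAt ℂ (laurentMonomial α) 1 := by
  unfold laurentMonomial
  refine Finset.analyticAt_fun_prod _ fun j _ => ?_
  exact ((ContinuousLinearMap.proj (R := ℂ) (φ := fun _ : Fin n => ℂ) j).analyticAt 1).fun_zpow
    (by simp)

theorem hasFDerivAt_laurentMonomial (α : Fin n → ℤ) :
    HasFDerivAt (laurentMonomial α)
      (∑ j, (α j : ℂ) • ContinuousLinearMap.proj (R := ℂ) (φ := fun _ : Fin n => ℂ) j) 1 := by
  have h : ∀ j, HasFDerivAt (fun y : Fin n → ℂ => y j ^ α j)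
      ((α j : ℂ) • ContinuousLinearMap.proj (R := ℂ) (φ := fun _ : Fin n => ℂ) j) 1 := by
    intro j
    have h1 := hasDerivAt_zpow (α j) ((1 : Fin n → ℂ) j) (Or.inl (by simp))
    simp only [Pi.one_apply, one_zpow, mul_one] at h1
    exact h1.comp_hasFDerivAt (1 : Fin n → ℂ)
      (ContinuousLinearMap.proj (R := ℂ) (φ := fun _ : Fin n => ℂ) j).hasFDerivAt
  have := HasFDerivAt.finsetProd (u := Finset.univ) fun j _ => h j
  change HasFDerivAt (fun y : Fin n → ℂ => ∏ j, y j ^ α j) _ _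
  simpa using this

theorem contDiffAt_trinomialMap : ContDiffAt ℂ ⊤ (trinomialMap β μ ν) (0, 1) := by
  have hm : ∀ α : Fin n → ℤ, AnalyticAt ℂ
      (fun p : (Fin n → ℂ) × (Fin n → ℂ) => laurentMonomial α p.2) (0, 1) := fun α =>
    AnalyticAt.fun_comp (f := fun p : (Fin n → ℂ) × (Fin n → ℂ) => p.2) (x := (0, 1))
      (analyticAt_laurentMonomial α) analyticAt_snd
  refine AnalyticAt.contDiffAt (analyticAt_pi_iff.2 fun i => ?_)
  refine AnalyticAt.fun_sub (AnalyticAt.fun_add (AnalyticAt.fun_mul ?_ (hm _)) (hm _)) (hm _)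
  exact (((ContinuousLinearMap.proj (R := ℂ) (φ := fun _ : Fin n => ℂ) i).comp
    (ContinuousLinearMap.fst ℂ (Fin n → ℂ) (Fin n → ℂ))).analyticAt _)

/-- At `(0, 1)` the Jacobian in `y` is the transpose of `κ`. -/
theorem isInvertible_fderiv_trinomialMap (hκ : (columnDiff μ ν).det ≠ 0) :
    (fderiv ℂ (trinomialMap β μ ν) (0, 1) ∘L .inr ℂ (Fin n → ℂ) (Fin n → ℂ)).IsInvertible := by
  set κ := columnDiff μ ν with hκ_def
  have hu : IsUnit κ.transpose.det := by simpa using hκ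
  have hf : HasFDerivAt (fun y => trinomialMap β μ ν ((0, y) : (Fin n → ℂ) × (Fin n → ℂ)))
      (fderiv ℂ (trinomialMap β μ ν) (0, 1) ∘L .inr ℂ (Fin n → ℂ) (Fin n → ℂ)) 1 :=
    ((contDiffAt_trinomialMap β μ ν).differentiableAt (by simp)).hasFDerivAt.comp (1 : Fin n → ℂ)
      (hasFDerivAt_prodMk_right (0 : Fin n → ℂ) (1 : Fin n → ℂ))
  have hg : HasFDerivAt (fun y => trinomialMap β μ ν ((0, y) : (Fin n → ℂ) × (Fin n → ℂ)))
      (LinearMap.toContinuousLinearMap κ.transpose.mulVecLin) 1 := by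
    rw [hasFDerivAt_pi']
    intro i
    have := (hasFDerivAt_laurentMonomial (μ i)).sub (hasFDerivAt_laurentMonomial (ν i))
    convert! this using 1
    · ext y
      simp [trinomialMap]
    · ext v
      simp [Matrix.vecMul, dotProduct, hκ_def, columnDiff, mul_sub, Finset.sum_sub_distrib, mul_comm]
  rw [hf.unique hg]
  refine .of_inverse (g := LinearMap.toContinuousLinearMap κ.transpose⁻¹.mulVecLin) ?_ ?_
  · ext v : 1
    change κ.transpose.mulVec (κ.transpose⁻¹.mulVec v) = v
    rw [Matrix.mulVec_mulVec, Matrix.mul_nonsing_inv _ hu, Matrix.one_mulVec]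
  · ext v : 1
    change κ.transpose⁻¹.mulVec (κ.transpose.mulVec v) = v
    rw [Matrix.mulVec_mulVec, Matrix.nonsing_inv_mul _ hu, Matrix.one_mulVec]

/-- The solution of the trinomial system near `(0, 1)` is given by an analytic function. -/
theorem exists_analyticAt_trinomialMap_eq_zero_iff (hκ : (columnDiff μ ν).det ≠ 0) :
    ∃ y : (Fin n → ℂ) → Fin n → ℂ, AnalyticAt ℂ y 0 ∧ y 0 = 1 ∧
      ∀ᶠ p in 𝓝 ((0, 1) : (Fin n → ℂ) × (Fin n → ℂ)), trinomialMap β μ ν p = 0 ↔ y p.1 = p.2 := by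
  have hc := contDiffAt_trinomialMap β μ ν
  have hi := isInvertible_fderiv_trinomialMap β μ ν hκ
  refine ⟨hc.implicitFunction (by simp) hi, ?_, hc.implicitFunction_apply_self _ hi, ?_⟩
  · exact (hc.contDiffAt_implicitFunction (by simp) hi).analyticAt
  · simpa only [trinomialMap_zero_one] using
      hc.eventually_apply_eq_iff_implicitFunction (by simp) hi

/-- Continuity of `z` suffices, so the sums of the series need not be shown analytic in `r`. -/
theorem eventually_eq_of_continuousAt {y z : (Fin n → ℂ) → Fin n → ℂ}
    (hy : ∀ᶠ p in 𝓝 ((0, 1) : (Fin n → ℂ) × (Fin n → ℂ)), trinomialMap β μ ν p = 0 ↔ y p.1 = p.2)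
    (hz : ContinuousAt z 0) (hz0 : z 0 = 1)
    (hs : ∀ᶠ r in 𝓝 0, trinomialMap β μ ν (r, z r) = 0) : z =ᶠ[𝓝 0] y := by
  have ht : Tendsto (fun r => (r, z r)) (𝓝 0) (𝓝 ((0, 1) : (Fin n → ℂ) × (Fin n → ℂ))) := by
    rw [nhds_prod_eq]
    refine tendsto_id.prodMk ?_
    simpa only [hz0] using hz.tendsto
  filter_upwards [ht.eventually hy, hs] with r h1 h2 using (h1.1 h2).symm

variable {β μ ν}

theorem IsPrincipalSolution.eventually_trinomialMap_eq_zero {y : (Fin n → ℂ) → Fin n → ℂ}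
    (h : IsPrincipalSolution β μ ν y) : ∀ᶠ r in 𝓝 0, trinomialMap β μ ν (r, y r) = 0 :=
  h.solves.mono fun _ hr => funext hr

variable (β μ ν)

/-- The sums of the series with the exponents `κ⁻¹ e j` solve the trinomial system. -/
theorem eventually_trinomialMap_goodSum (hκ : (columnDiff μ ν).det ≠ 0) :
    ∀ᶠ r in 𝓝 (0 : Fin n → ℂ), trinomialMap β μ ν (r, fun j =>
      goodSum ((columnDiff μ ν)⁻¹ * columnDiff β ν) ((columnDiff μ ν)⁻¹.col j) r) = 0 := by
  set κ := columnDiff μ ν with hκ_def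
  set M := κ⁻¹ * columnDiff β ν with hM
  set c : (Fin n → ℤ) → Fin n → ℂ := fun α j => (α j : ℂ) with hc
  have hmul : ∀ α : Fin n → ℤ, ∀ᶠ r in 𝓝 (0 : Fin n → ℂ),
      laurentMonomial α (fun j => goodSum M (κ⁻¹.col j) r) = goodSum M (κ⁻¹.mulVec (c α)) r := by
    intro α
    filter_upwards [eventually_goodSum_mulVec M κ⁻¹ (c α)] with r hr
    rw [hr]
    simp only [laurentMonomial, hc, Complex.cpow_intCast]
  have hcol : ∀ (α : Fin n → Fin n → ℤ) i, (columnDiff α ν).col i = c (α i) - c (ν i) := by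
    intro α i
    ext j
    simp [columnDiff, hc]
  have hβ : ∀ i, κ⁻¹.mulVec (c (β i)) = κ⁻¹.mulVec (c (ν i)) + M.col i := by
    intro i
    rw [hM, ← Matrix.mulVec_single_one (κ⁻¹ * _), ← Matrix.mulVec_mulVec,
      Matrix.mulVec_single_one, hcol, ← Matrix.mulVec_add, add_sub_cancel]
  have hμ : ∀ i, κ⁻¹.mulVec (c (μ i)) = κ⁻¹.mulVec (c (ν i)) + Pi.single i 1 := by
    intro i
    have h1 : (κ⁻¹ * κ).mulVec (Pi.single i 1) = Pi.single i 1 := by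
      rw [Matrix.nonsing_inv_mul _ (isUnit_iff_ne_zero.2 hκ), Matrix.one_mulVec]
    rw [← h1, ← Matrix.mulVec_mulVec, Matrix.mulVec_single_one, hκ_def, hcol,
      ← Matrix.mulVec_add, add_sub_cancel]
  have hall : ∀ v : Fin n → ℂ, ∀ᶠ r in 𝓝 (0 : Fin n → ℂ), GoodSummable M v r := fun v =>
    (eventually_goodSummable M ‖v‖).mono fun r hr => hr v le_rfl
  have : ∀ i, ∀ᶠ r in 𝓝 (0 : Fin n → ℂ), trinomialMap β μ ν (r, fun j =>
      goodSum M (κ⁻¹.col j) r) i = 0 := by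
    intro i
    filter_upwards [hmul (β i), hmul (μ i), hmul (ν i), hall (κ⁻¹.mulVec (c (ν i))),
      -- After factoring out the power for `ν i`, the equation is `goodSum_single`.
      hall (M.col i), hall (Pi.single i 1)] with r h1 h2 h3 s1 s2 s3
    simp only [trinomialMap, h1, h2, h3, hβ, hμ]
    rw [goodSum_add s1 s2, goodSum_add s1 s3, goodSum_single i s2 s3]
    ring
  filter_upwards [eventually_all.2 this] with r hr using funext hr

theorem continuousAt_goodSum (δ : Fin n → ℂ) : ContinuousAt (goodSum M δ) 0 := by
  rw [Metric.continuousAt_iff']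
  intro ε hε
  filter_upwards [eventually_norm_goodSum_sub_one_lt M ‖δ‖ hε] with r hr
  rw [goodSum_zero_right, dist_eq_norm]
  exact hr δ le_rfl

end

theorem theorem1 (n : ℕ) (β μ ν : Fin n → Fin n → ℤ)
    (hκ : (columnDiff μ ν).det ≠ 0) (d : Fin n → ℝ) :
    -- the principal solution exists and is unique as a germ at the origin
    (∃ y, IsPrincipalSolution β μ ν y ∧
      ∀ z, IsPrincipalSolution β μ ν z → z =ᶠ[𝓝 0] y) ∧
    ∃ c : (Fin n → ℕ) → ℂ,
      -- `c k` is given by the formula, removable singularities being removed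
      (∀ k, IsCoeffValue (columnDiff μ ν) (columnDiff β ν) (fun j => (d j : ℂ)) k (c k)) ∧
      (∀ k, (fun j => (d j : ℂ)) ∈ regularSet (columnDiff μ ν) (columnDiff β ν) k →
        c k = coeffFormula (columnDiff μ ν) (columnDiff β ν) (fun j => (d j : ℂ)) k) ∧
      -- the monomial of the principal solution is the sum of its Taylor series near the origin
      ∀ y, IsPrincipalSolution β μ ν y →
        ∀ᶠ r in 𝓝 (0 : Fin n → ℂ),
          HasSum (fun k : Fin n → ℕ => c k * ∏ i, r i ^ k i)
            (∏ j, y r j ^ ((d j : ℝ) : ℂ)) := by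
  obtain ⟨y, hya, hy0, hy⟩ := exists_analyticAt_trinomialMap_eq_zero_iff β μ ν hκ
  have huniq : ∀ z, IsPrincipalSolution β μ ν z → z =ᶠ[𝓝 0] y := fun z hz =>
    eventually_eq_of_continuousAt β μ ν hy hz.analyticAt_zero.continuousAt
      (funext hz.apply_zero) hz.eventually_trinomialMap_eq_zero
  -- The witness for `c`, found by unification, is `goodCoeff` at `κ⁻¹ d`.
  refine ⟨⟨y, ⟨hya, fun j => by rw [hy0, Pi.one_apply], ?_⟩, huniq⟩, _,
    isCoeffValue_goodCoeff _ _ _, fun k hk => (coeffFormula_eq_goodCoeff hk).symm, ?_⟩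
  · have ht : Tendsto (fun r => (r, y r)) (𝓝 0) (𝓝 ((0, 1) : (Fin n → ℂ) × (Fin n → ℂ))) := by
      rw [nhds_prod_eq]
      refine tendsto_id.prodMk ?_
      simpa only [hy0] using hya.continuousAt.tendsto
    filter_upwards [ht.eventually hy] with r hr i using congrFun (hr.2 rfl) i
  · intro z hz
    set κ := columnDiff μ ν
    set M := κ⁻¹ * columnDiff β ν
    set dc : Fin n → ℂ := fun j => (d j : ℂ) with hdc
    have hw : (fun r j => goodSum M (κ⁻¹.col j) r) =ᶠ[𝓝 0] y :=
      eventually_eq_of_continuousAt β μ ν hy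
        (continuousAt_pi.2 fun j => continuousAt_goodSum M _)
        (funext fun j => goodSum_zero_right _) (eventually_trinomialMap_goodSum β μ ν hκ)
    filter_upwards [huniq z hz, hw, eventually_goodSum_mulVec M κ⁻¹ dc,
      eventually_goodSummable M ‖κ⁻¹.mulVec dc‖] with r hzr hwr hr hs
    have := (hs _ le_rfl).hasSum
    rw [hr] at this
    simpa only [hzr, ← hwr] using this
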